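/- Let all von Neumann algebras act on complex Hilbert spaces of arbitrary dimension and contain the identity operator. A set $S\subseteq\mathcal M$ generates the von Neumann algebra $\mathcal M\subseteq\mathcal B(\mathfrak H)$ if $\mathcal M$ is the smallest von Neumann algebra on $\mathfrak H$ containing $S$; $\mathcal M$ is singly generated (countably generated) if it is generated by a single element (by a countable set). Call $\mathcal M$ separably-acting if it has a faithful normal ($\sigma$-weakly continuous) unital $*$-representation on some separable Hilbert space. Theorem. The following two statements are equivalent: (1) every separably-acting von Neumann algebra is singly generated; (2) every countably generated von Neumann algebra is singly generated. In particular, if every separably-acting von Neumann algebra is singly generated, then every countably generated von Neumann algebra is singly generated. -/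

import Mathlib

universe u v

/-- `M` is generated by `S`: it is the smallest von Neumann algebra on `H` that contains `S`. -/
def VonNeumannAlgebra.IsGeneratedBy {H : Type u} [NormedAddCommGroup H] [InnerProductSpace ℂ H]
    [CompleteSpace H] (M : VonNeumannAlgebra H) (S : Set (H →L[ℂ] H)) : Prop :=
  S ⊆ (M : Set (H →L[ℂ] H)) ∧ ∀ N : VonNeumannAlgebra H, S ⊆ (N : Set (H →L[ℂ] H)) → M ≤ N

/-- `M` is generated by a single element. -/
def VonNeumannAlgebra.IsSinglyGenerated {H : Type u} [NormedAddCommGroup H]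
    [InnerProductSpace ℂ H] [CompleteSpace H] (M : VonNeumannAlgebra H) : Prop :=
  ∃ x : H →L[ℂ] H, M.IsGeneratedBy {x}

/-- `M` is generated by a countable set. -/
def VonNeumannAlgebra.IsCountablyGenerated {H : Type u} [NormedAddCommGroup H]
    [InnerProductSpace ℂ H] [CompleteSpace H] (M : VonNeumannAlgebra H) : Prop :=
  ∃ S : Set (H →L[ℂ] H), S.Countable ∧ M.IsGeneratedBy S

/-- The `σ`-weak (ultraweak) topology on `B(H)`: the coarsest topology for which
`T ↦ ∑ₙ ⟪ηₙ, T ξₙ⟫` is continuous whenever `∑ₙ ‖ξₙ‖² < ∞` and `∑ₙ ‖ηₙ‖² < ∞`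
(these series converge absolutely). -/
noncomputable abbrev sigmaWeakTopology (H : Type u) [NormedAddCommGroup H] [InnerProductSpace ℂ H] :
    TopologicalSpace (H →L[ℂ] H) :=
  ⨅ (ξ : ℕ → H) (η : ℕ → H) (_ : Summable fun n => ‖ξ n‖ ^ 2) (_ : Summable fun n => ‖η n‖ ^ 2),
    TopologicalSpace.induced (fun T : H →L[ℂ] H => ∑' n, inner ℂ (η n) (T (ξ n)))
      (inferInstance : TopologicalSpace ℂ)

/-- A unital *-representation of `M` on a Hilbert space `K` is normal if it is continuous for the
`σ`-weak topologies of `M` and of `B(K)`. -/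
def VonNeumannAlgebra.IsNormalRep {H : Type u} [NormedAddCommGroup H] [InnerProductSpace ℂ H]
    [CompleteSpace H] (M : VonNeumannAlgebra H) {K : Type v} [NormedAddCommGroup K]
    [InnerProductSpace ℂ K] [CompleteSpace K]
    (π : M.toStarSubalgebra →⋆ₐ[ℂ] (K →L[ℂ] K)) : Prop :=
  @Continuous M.toStarSubalgebra (K →L[ℂ] K)
    (TopologicalSpace.induced Subtype.val (sigmaWeakTopology H)) (sigmaWeakTopology K) π

/-- `M` is separably-acting: it has a faithful normal representation on some separable Hilbert
space. (The space `H` on which `M` is given need not itself be separable.) -/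
def VonNeumannAlgebra.IsSeparablyActing {H : Type u} [NormedAddCommGroup H]
    [InnerProductSpace ℂ H] [CompleteSpace H] (M : VonNeumannAlgebra H) : Prop :=
  ∃ (K : Type u) (_ : NormedAddCommGroup K) (_ : InnerProductSpace ℂ K) (_ : CompleteSpace K)
    (_ : TopologicalSpace.SeparableSpace K) (π : M.toStarSubalgebra →⋆ₐ[ℂ] (K →L[ℂ] K)),
    Function.Injective π ∧ M.IsNormalRep π

/-! A separably-acting algebra is countably generated
(`VonNeumannAlgebra.IsSeparablyActing.isCountablyGenerated`): its unit ball is weak-operator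
compact, and countably many matrix coefficients of a faithful normal representation embed it in a
second countable space. A countable dense subset of the ball generates.

For the other implication, let a countable self-adjoint set `S` generate `M`. Split the space into
orthogonal central subspaces, each spanned by the vectors `R w ξ` with `R` in the commutant of `S`
and `w` a word in `S`. On such a summand the compressed algebra is separably acting
(`VonNeumannAlgebra.isSeparablyActing_of_total`), because it acts faithfully on the closed span of
the `w ξ`. The hypothesis then gives one contraction per summand, and these add up to an operator
`Y`.

There may be uncountably many summands, but the numbers `⟪ξ, w ξ⟫` tell them apart
(`eq_zero_of_forall_inner_eq`). So binary sequences can label them, and countably many projections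
`Q n`, one per digit, separate them. The commutant of `M` consists of the operators commuting with
`Y`, `star Y` and all `Q n`. Finally `exists_centralizer_eq_of_commuting_projections` folds `Y` and
the `Q n` into one operator: the digits of the real part of `Y` are merged with the `Q n` into one
self-adjoint element, and the skew part is added back. -/

/-! ### Encoding commuting projections in one self-adjoint element -/

section DigitEncoding

variable {A : Type*} [NormedRing A]

/-- If `c = p + d` with `p` an idempotent commuting with the small element `d`, then everything
that commutes with `c` commutes with `p`. -/
theorem commute_of_commute_add_small {p d t : A} (hp : IsIdempotentElem p) (hpd : Commute p d)
    (hd : ‖d‖ ≤ 1 / 3) (h : Commute t (p + d)) : Commute t p := by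
  have hp' : p * p = p := hp
  have hpd' : p * d = d * p := hpd
  have h' : t * p + t * d = p * t + d * t := by simpa [mul_add, add_mul] using h.eq
  have small : ∀ r : A, ‖r‖ ≤ ‖d * r‖ + ‖r * d‖ → r = 0 := by
    intro r hr
    have h1 := norm_mul_le d r
    have h2 := norm_mul_le r d
    have h3 := mul_le_mul_of_nonneg_right hd (norm_nonneg r)
    have : ‖r‖ ≤ 0 := by nlinarith
    exact norm_le_zero_iff.1 this
  have hp2 : ∀ x, p * (p * x) = p * x := fun x => by rw [← mul_assoc, hp']
  have hpd2 : ∀ x, d * (p * x) = p * (d * x) := fun x => by rw [← mul_assoc, ← hpd', mul_assoc]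
  -- The corner `r = (1 - p) t p` satisfies `r = d r - r d`, so its norm is at most `2/3` of itself.
  -- The opposite corner is treated in the same way.
  have h1 : t * p - p * t * p = 0 := by
    refine small _ ?_
    have e : t * p - p * t * p = d * (t * p - p * t * p) - (t * p - p * t * p) * d := by
      refine eq_sub_of_add_eq ?_
      calc t * p - p * t * p + (t * p - p * t * p) * d = (1 - p) * (t * p + t * d) * p := by
            simp only [sub_mul, mul_add, add_mul, one_mul, mul_assoc, hp', ← hpd']
        _ = (1 - p) * (p * t + d * t) * p := by rw [h']
        _ = _ := by
            simp only [mul_sub, sub_mul, mul_add, add_mul, one_mul, mul_assoc, hp2, hpd2]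
            abel
    exact (congrArg norm e).trans_le (norm_sub_le _ _)
  have h2 : p * t - p * t * p = 0 := by
    refine small _ ?_
    have e : p * t - p * t * p = (p * t - p * t * p) * d - d * (p * t - p * t * p) := by
      refine eq_sub_of_add_eq ?_
      calc p * t - p * t * p + d * (p * t - p * t * p) = p * (p * t + d * t) * (1 - p) := by
            simp only [mul_sub, mul_add, add_mul, mul_one, mul_assoc, hp2, hpd2]
            abel
        _ = p * (t * p + t * d) * (1 - p) := by rw [h']
        _ = _ := by
            simp only [mul_sub, sub_mul, mul_add, add_mul, mul_one, mul_assoc, hp', ← hpd']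
            abel
    rw [add_comm]
    exact (congrArg norm e).trans_le (norm_sub_le _ _)
  exact (sub_eq_zero.1 h1).trans (sub_eq_zero.1 h2).symm

end DigitEncoding

section Encoding

variable {A : Type*} [CStarAlgebra A]

/-- A sequence of pairwise commuting projections is encoded, up to commutants, in the digits of one
self-adjoint element. -/
theorem exists_selfAdjoint_commute_iff_forall_commute {p : ℕ → A}
    (hp : ∀ n, IsStarProjection (p n)) (hc : ∀ m n, Commute (p m) (p n)) :
    ∃ c : A, IsSelfAdjoint c ∧ ∀ t, Commute t c ↔ ∀ n, Commute t (p n) := by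
  have hnorm : ∀ k n, ‖((1 / 4 : ℝ) ^ n) • p (n + k)‖ ≤ (1 / 4 : ℝ) ^ n := by
    intro k n
    rw [norm_smul, Real.norm_of_nonneg (by positivity)]
    exact mul_le_of_le_one_right (by positivity) (hp _).norm_le
  have hg : HasSum (fun n : ℕ => (1 / 4 : ℝ) ^ n) (4 / 3) := by
    convert hasSum_geometric_of_lt_one (r := (1 / 4 : ℝ)) (by norm_num) (by norm_num) using 1
    norm_num
  have hs : ∀ k, Summable fun n : ℕ => ((1 / 4 : ℝ) ^ n) • p (n + k) := fun k =>
    Summable.of_norm_bounded hg.summable (hnorm k)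
  -- `c k` has leading digit `p k`. In base four the remaining tail has norm at most `1/4 * 4/3 =
  -- 1/3`, the bound needed to split off that digit.
  set c : ℕ → A := fun k => ∑' n : ℕ, ((1 / 4 : ℝ) ^ n) • p (n + k) with hcdef
  have hcn : ∀ k, ‖c k‖ ≤ 4 / 3 := fun k => tsum_of_norm_bounded hg (hnorm k)
  have hrec : ∀ k, c k = p k + (1 / 4 : ℝ) • c (k + 1) := by
    intro k
    simp only [hcdef]
    rw [(hs k).tsum_eq_zero_add, ← (hs (k + 1)).tsum_const_smul]
    simp [pow_succ', smul_smul, add_assoc, add_comm 1 k]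
  have hcomm : ∀ t, (∀ n, Commute t (p n)) → ∀ k, Commute t (c k) := by
    intro t ht k
    have h1 := (hs k).tsum_mul_left t
    have h2 := (hs k).tsum_mul_right t
    refine h1.symm.trans (Eq.trans ?_ h2)
    exact tsum_congr fun n => (ht _).smul_right _
  refine ⟨c 0, ?_, fun t => ⟨fun ht => ?_, fun ht => hcomm t ht 0⟩⟩
  · simp only [IsSelfAdjoint, hcdef]
    rw [tsum_star]
    refine tsum_congr fun n => ?_
    rw [star_smul, (hp _).isSelfAdjoint.star_eq, star_trivial]
  · have step : ∀ k, Commute t (c k) → Commute t (p k) ∧ Commute t (c (k + 1)) := by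
      intro k hk
      have h1 : Commute t (p k) := by
        refine commute_of_commute_add_small (hp k).isIdempotentElem
          (d := (1 / 4 : ℝ) • c (k + 1)) ((hcomm _ (hc k) _).smul_right _) ?_ ?_
        · rw [norm_smul, Real.norm_of_nonneg (by norm_num)]
          linarith [hcn (k + 1)]
        · rwa [← hrec]
      refine ⟨h1, ?_⟩
      have h2 : c (k + 1) = (4 : ℝ) • (c k - p k) := by
        rw [hrec k, add_sub_cancel_left, smul_smul]
        norm_num
      rw [h2]
      exact (hk.sub_right h1).smul_right _
    have all : ∀ k, Commute t (c k) := fun k => Nat.rec ht (fun k ih => (step k ih).2) k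
    exact fun n => (step n (all n)).1

/-- Every self-adjoint element has the same commutant as some positive contraction. -/
theorem IsSelfAdjoint.exists_nonneg_le_one_commute_iff [PartialOrder A] [StarOrderedRing A]
    {s : A} (hs : IsSelfAdjoint s) :
    ∃ a : A, 0 ≤ a ∧ a ≤ 1 ∧ ∀ t, Commute t a ↔ Commute t s := by
  -- The `+ 1` keeps the scaling invertible when `s = 0`.
  have hpos : 0 < ‖s‖ + 1 := by positivity
  have hbd : algebraMap ℝ A ‖s‖ ≤ algebraMap ℝ A (‖s‖ + 1) := algebraMap_mono A (by linarith)
  have hle : s ≤ algebraMap ℝ A (‖s‖ + 1) := hs.le_algebraMap_norm_self.trans hbd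
  have hge : 0 ≤ algebraMap ℝ A (‖s‖ + 1) + s :=
    neg_le_iff_add_nonneg'.1 ((neg_le_neg hbd).trans hs.neg_algebraMap_norm_le_self)
  generalize ‖s‖ + 1 = r at hpos hle hge
  refine ⟨(2 * r)⁻¹ • (algebraMap ℝ A r + s), smul_nonneg (by positivity) hge, ?_, fun t => ?_⟩
  · have h : (2 * r)⁻¹ • (algebraMap ℝ A r + s) ≤
        (2 * r)⁻¹ • (algebraMap ℝ A r + algebraMap ℝ A r) :=
      smul_le_smul_of_nonneg_left (add_le_add_right hle _) (by positivity)
    refine h.trans_eq ?_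
    rw [← map_add, ← two_mul, Algebra.smul_def, ← map_mul, inv_mul_cancel₀ (by positivity),
      map_one]
  · constructor
    · intro h
      have h' := h.smul_right (2 * r)
      rw [smul_smul, mul_inv_cancel₀ (by positivity), one_smul] at h'
      simpa using h'.sub_right (Algebra.commutes r t).symm
    · exact fun h => ((show Commute t (algebraMap ℝ A r) from (Algebra.commutes r t).symm).add_right
        h).smul_right _

end Encoding

/-! ### Binary digits of a positive contraction -/

section Digits

variable {H : Type u} [NormedAddCommGroup H] [InnerProductSpace ℂ H] [CompleteSpace H]

open ContinuousLinearMap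

/-- An operator that leaves a closed subspace reducing commutes with the projection onto it. -/
theorem Submodule.commute_starProjection_of_invariant {U : Submodule ℂ H}
    [U.HasOrthogonalProjection] {T : H →L[ℂ] H} (h1 : ∀ v ∈ U, T v ∈ U)
    (h2 : ∀ v ∈ U, star T v ∈ U) : Commute T U.starProjection := by
  ext v
  refine (U.eq_starProjection_of_mem_orthogonal (h1 _ (U.starProjection_apply_mem v)) ?_).symm
  intro u hu
  change inner ℂ u (T v - T (U.starProjection v)) = 0
  rw [← map_sub]
  rw [← adjoint_inner_left]
  exact (U.sub_starProjection_mem_orthogonal v) _ (h2 u hu)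

/-- The first binary digit of a positive contraction. -/
theorem exists_isStarProjection_two_smul_sub {a : H →L[ℂ] H} (h0 : 0 ≤ a) (h1 : a ≤ 1) :
    ∃ p : H →L[ℂ] H, IsStarProjection p ∧ (∀ t, Commute t a → Commute (star t) a → Commute t p) ∧
      0 ≤ 2 • a - p ∧ 2 • a - p ≤ 1 := by
  set b : H →L[ℂ] H := 2 • a - 1 with hb
  have hasa : IsSelfAdjoint a := .of_nonneg h0
  have hbsa : IsSelfAdjoint b := by
    rw [hb, two_nsmul]
    exact (hasa.add hasa).sub (.one _)
  -- The projection onto `U` is the spectral projection of `a` for the interval `(1/2, 1]`.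
  set U : Submodule ℂ H := (b⁺ : H →L[ℂ] H).range.topologicalClosure with hU
  have hUc : IsClosed (U : Set H) := Submodule.isClosed_topologicalClosure _
  have : CompleteSpace U := hUc.completeSpace_coe
  set p := U.starProjection with hp
  have hpp : IsStarProjection p := isStarProjection_starProjection
  have hinv : ∀ t, Commute t a → ∀ v ∈ U, t v ∈ U := by
    intro t ht v hv
    have htb : Commute t b := by
      rw [hb, two_nsmul]
      exact (ht.add_right ht).sub_right (.one_right _)
    have htp : Commute t b⁺ := by
      rw [CFC.posPart_def]
      exact (htb.symm.cfcₙ_real _).symm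
    refine (map_mem_closure t.continuous hv ?_ : t v ∈ closure _)
    rintro _ ⟨w, rfl⟩
    exact ⟨t w, (congrArg (fun z : H →L[ℂ] H => z w) htp.eq).symm⟩
  have hpos : p * b⁺ = b⁺ := by
    ext v
    exact U.starProjection_eq_self_iff.2 (subset_closure ⟨v, rfl⟩)
  have hneg : b⁻ * p = 0 := by
    have hz : ∀ v ∈ U, (b⁻ : H →L[ℂ] H) v = 0 := by
      intro v hv
      refine closure_minimal (s := ((b⁺ : H →L[ℂ] H).range : Set H))
        (t := {v | (b⁻ : H →L[ℂ] H) v = 0}) ?_ (isClosed_eq (by fun_prop) continuous_const) hv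
      rintro _ ⟨w, rfl⟩
      exact congrArg (fun z : H →L[ℂ] H => z w) (CFC.negPart_mul_posPart b)
    ext v
    exact hz _ (U.starProjection_apply_mem v)
  have hpsa := hpp.isSelfAdjoint.star_eq
  have hpos' : b⁺ * p = b⁺ := by
    have := congrArg star hpos
    rwa [star_mul, hpsa, (IsSelfAdjoint.of_nonneg (CFC.posPart_nonneg b)).star_eq] at this
  have hneg' : p * b⁻ = 0 := by
    have := congrArg star hneg
    rwa [star_mul, hpsa, (IsSelfAdjoint.of_nonneg (CFC.negPart_nonneg b)).star_eq,
      star_zero] at this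
  have hbd := CFC.posPart_sub_negPart b hbsa
  have hpi : p * p = p := hpp.isIdempotentElem
  have hb1 : b ≤ 1 := by
    rw [hb, two_nsmul, sub_le_iff_le_add]
    exact add_le_add h1 h1
  have hb2 : -1 ≤ b := by
    rw [hb, two_nsmul, neg_le_sub_iff_le_add]
    simpa using add_nonneg h0 h0
  -- Conjugating `b ≤ 1` by `p` leaves `b⁺`; conjugating `-1 ≤ b` by `1 - p` leaves `-b⁻`.
  have e1 : b⁺ ≤ p := by
    have := hpp.isSelfAdjoint.conjugate_le_conjugate hb1
    rw [← hbd, mul_sub, sub_mul, hpos, hpos', hneg', zero_mul, sub_zero, mul_one, hpi] at this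
    exact this
  have e2 : b⁻ ≤ 1 - p := by
    have := hpp.one_sub.isSelfAdjoint.conjugate_le_conjugate hb2
    have e : (1 - p) * b * (1 - p) = -b⁻ := by
      have : (1 - p) * (b⁺ - b⁻) * (1 - p) = -b⁻ := by
        simp only [mul_sub, sub_mul, one_mul, mul_one, hpos, hpos', hneg', hneg, zero_mul]
        abel
      rwa [hbd] at this
    have e' : (1 - p) * -1 * (1 - p) = -(1 - p) := by
      rw [mul_neg, mul_one, neg_mul, hpp.one_sub.isIdempotentElem.eq]
    rw [e, e'] at this
    exact neg_le_neg_iff.1 this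
  have ea : 2 • a - p = b⁺ + (1 - p - b⁻) := by
    have : 2 • a = b⁺ - b⁻ + 1 := by rw [hbd, hb]; abel
    rw [this]; abel
  refine ⟨p, hpp, fun t ht ht' => ?_, ?_, ?_⟩
  · exact Submodule.commute_starProjection_of_invariant (hinv t ht) (hinv _ ht')
  · rw [ea]
    exact add_nonneg (CFC.posPart_nonneg b) (sub_nonneg.2 e2)
  · rw [ea]
    calc b⁺ + (1 - p - b⁻) ≤ p + (1 - p - 0) :=
          add_le_add e1 (sub_le_sub_left (CFC.negPart_nonneg b) _)
      _ = 1 := by abel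

/-- A positive contraction is determined, up to commutants, by its binary digits. -/
theorem exists_digit_projections {a : H →L[ℂ] H} (h0 : 0 ≤ a) (h1 : a ≤ 1) :
    ∃ p : ℕ → H →L[ℂ] H, (∀ n, IsStarProjection (p n)) ∧
      ∀ t, Commute t a ↔ ∀ n, Commute t (p n) := by
  let X := {a : H →L[ℂ] H // 0 ≤ a ∧ a ≤ 1}
  choose d hd1 hd2 hd3 hd4 using fun x : X => exists_isStarProjection_two_smul_sub x.2.1 x.2.2
  let x : ℕ → X := fun n => Nat.rec ⟨a, h0, h1⟩ (fun _ y => ⟨2 • y.1 - d y, hd3 y, hd4 y⟩) n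
  have hx : ∀ n, (x (n + 1)).1 = 2 • (x n).1 - d (x n) := fun n => rfl
  refine ⟨fun n => d (x n), fun n => hd1 _, fun t => ⟨fun ht => ?_, fun ht => ?_⟩⟩
  · have ht' : Commute (star t) a := by
      have := ht.star_star
      rwa [(IsSelfAdjoint.of_nonneg h0).star_eq] at this
    have key : ∀ n, Commute t (x n).1 ∧ Commute (star t) (x n).1 := by
      intro n
      induction n with
      | zero => exact ⟨ht, ht'⟩
      | succ n ih =>
        rw [hx, two_nsmul]
        exact ⟨(ih.1.add_right ih.1).sub_right (hd2 _ _ ih.1 ih.2),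
          (ih.2.add_right ih.2).sub_right (hd2 _ _ ih.2 (by rw [star_star]; exact ih.1))⟩
    exact fun n => hd2 _ _ (key n).1 (key n).2
  · have hn : ∀ n, ‖(x n).1‖ ≤ 1 := fun n =>
      (CStarAlgebra.norm_le_one_iff_of_nonneg _ (x n).2.1).2 (x n).2.2
    -- Since `t` commutes with the digits, each doubling step doubles the commutator; the remainders
    -- `x n` stay in the unit ball, so the original commutator is zero.
    have key : ∀ n, t * (x 0).1 - (x 0).1 * t =
        ((1 / 2 : ℝ) ^ n) • (t * (x n).1 - (x n).1 * t) := by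
      intro n
      induction n with
      | zero => simp
      | succ n ih =>
        rw [ih, hx, pow_succ, mul_smul]
        congr 1
        have : t * d (x n) = d (x n) * t := (ht n).eq
        have e : t * (2 • (x n).1 - d (x n)) - (2 • (x n).1 - d (x n)) * t =
            (2 : ℝ) • (t * (x n).1 - (x n).1 * t) := by
          rw [two_smul ℝ, two_nsmul, mul_sub, sub_mul, this, mul_add, add_mul]
          abel
        rw [e, smul_smul]
        norm_num
    have hz : ‖t * (x 0).1 - (x 0).1 * t‖ ≤ 0 := by
      have lim : Filter.Tendsto (fun n : ℕ => (1 / 2 : ℝ) ^ n * (2 * ‖t‖)) Filter.atTop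
          (nhds (0 * (2 * ‖t‖))) :=
        (tendsto_pow_atTop_nhds_zero_of_lt_one (by norm_num) (by norm_num)).mul_const _
      rw [zero_mul] at lim
      refine ge_of_tendsto' lim fun n => ?_
      rw [key n, norm_smul, Real.norm_of_nonneg (by positivity)]
      refine mul_le_mul_of_nonneg_left ?_ (by positivity)
      have h1 := (norm_mul_le t (x n).1).trans
        (mul_le_of_le_one_right (norm_nonneg _) (hn n))
      have h2 := (norm_mul_le (x n).1 t).trans
        (mul_le_of_le_one_left (norm_nonneg _) (hn n))
      linarith [norm_sub_le (t * (x n).1) ((x n).1 * t)]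
    exact sub_eq_zero.1 (norm_le_zero_iff.1 hz)

/-- One operator together with a sequence of projections in its commutant can be replaced, up to
commutants, by one operator. -/
theorem exists_centralizer_eq_of_commuting_projections {y : H →L[ℂ] H} {q : ℕ → H →L[ℂ] H}
    (hq : ∀ n, IsStarProjection (q n)) (hqq : ∀ m n, Commute (q m) (q n))
    (hqy : ∀ n, Commute (q n) y) :
    ∃ x : H →L[ℂ] H, ∀ t, (Commute t x ∧ Commute t (star x)) ↔
      (Commute t y ∧ Commute t (star y) ∧ ∀ n, Commute t (q n)) := by
  have hqy' : ∀ n, Commute (q n) (star y) := fun n => by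
    have := (hqy n).star_star
    rwa [(hq n).isSelfAdjoint.star_eq] at this
  set s : H →L[ℂ] H := y + star y with hs
  have hssa : IsSelfAdjoint s := .add_star_self y
  obtain ⟨a, ha0, ha1, hat⟩ := hssa.exists_nonneg_le_one_commute_iff
  obtain ⟨p, hp, hpa⟩ := exists_digit_projections ha0 ha1
  have hpp : ∀ m n, Commute (p m) (p n) := fun m =>
    (hpa _).1 ((hpa a).1 (Commute.refl a) m).symm
  have hpq : ∀ m n, Commute (q m) (p n) := fun m =>
    (hpa _).1 ((hat _).2 ((hqy m).add_right (hqy' m)))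
  -- The digits `p` of the real part commute with the `q n`, so both sequences can be interleaved
  -- and encoded together.
  obtain ⟨c, hcsa, hc⟩ := exists_selfAdjoint_commute_iff_forall_commute
    (p := fun n => Sum.elim p q (Equiv.natSumNatEquivNat.symm n))
    (fun n => by
      rcases Equiv.natSumNatEquivNat.symm n with k | k
      · exact hp k
      · exact hq k)
    (fun m n => by
      rcases Equiv.natSumNatEquivNat.symm m with k | k <;>
        rcases Equiv.natSumNatEquivNat.symm n with l | l
      · exact hpp k l
      · exact (hpq l k).symm
      · exact hpq k l
      · exact hqq k l)
  have hc' : ∀ t, Commute t c ↔ Commute t s ∧ ∀ n, Commute t (q n) := by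
    intro t
    rw [hc, ← hat, hpa]
    refine ⟨fun h => ⟨fun n => ?_, fun n => ?_⟩, fun h n => ?_⟩
    · simpa using h (Equiv.natSumNatEquivNat (Sum.inl n))
    · simpa using h (Equiv.natSumNatEquivNat (Sum.inr n))
    · rcases Equiv.natSumNatEquivNat.symm n with k | k
      · exact h.1 k
      · exact h.2 k
  -- `c` is self-adjoint and `y - star y` is skew, so this operator and its adjoint recover both.
  refine ⟨c + (y - star y), fun t => ?_⟩
  have hstar : star (c + (y - star y)) = c - (y - star y) := by
    rw [star_add, star_sub, star_star, hcsa.star_eq]; abel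
  rw [hstar]
  have half : ∀ u v : H →L[ℂ] H, Commute t (u + v) → Commute t (u - v) →
      Commute t u ∧ Commute t v := by
    intro u v h1 h2
    have e1 : u = (1 / 2 : ℝ) • ((u + v) + (u - v)) := by module
    have e2 : v = (1 / 2 : ℝ) • ((u + v) - (u - v)) := by module
    constructor
    · rw [e1]; exact (h1.add_right h2).smul_right _
    · rw [e2]; exact (h1.sub_right h2).smul_right _
  constructor
  · rintro ⟨h1, h2⟩
    obtain ⟨h3, h4⟩ := half _ _ h1 h2
    obtain ⟨h5, h6⟩ := (hc' t).1 h3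
    obtain ⟨h7, h8⟩ := half _ _ h5 h4
    exact ⟨h7, h8, h6⟩
  · rintro ⟨h1, h2, h3⟩
    have h4 := (hc' t).2 ⟨h1.add_right h2, h3⟩
    have h5 := h1.sub_right h2
    exact ⟨h4.add_right h5, h4.sub_right h5⟩

end Digits

/-! ### Generation in terms of commutants -/

section Generation

variable {H : Type u} [NormedAddCommGroup H] [InnerProductSpace ℂ H] [CompleteSpace H]

namespace VonNeumannAlgebra

/-- The von Neumann algebra generated by a set of operators. -/
noncomputable def generatedBy (S : Set (H →L[ℂ] H)) : VonNeumannAlgebra H where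
  toStarSubalgebra := StarSubalgebra.centralizer ℂ (Set.centralizer (S ∪ star S))
  centralizer_centralizer' := by
    change Set.centralizer (Set.centralizer
      (StarSubalgebra.centralizer ℂ (Set.centralizer (S ∪ star S)) : Set (H →L[ℂ] H))) =
      (StarSubalgebra.centralizer ℂ (Set.centralizer (S ∪ star S)) : Set (H →L[ℂ] H))
    simp

theorem coe_generatedBy (S : Set (H →L[ℂ] H)) :
    (generatedBy S : Set (H →L[ℂ] H)) = Set.centralizer (Set.centralizer (S ∪ star S)) := by
  have hstar : star (Set.centralizer (S ∪ star S)) = Set.centralizer (S ∪ star S) := by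
    ext x
    rw [← StarSubalgebra.coe_centralizer (R := ℂ), Set.mem_star]
    exact star_mem_iff
  change (StarSubalgebra.centralizer ℂ (Set.centralizer (S ∪ star S)) : Set (H →L[ℂ] H)) = _
  rw [StarSubalgebra.coe_centralizer, hstar, Set.union_self]

/-- By the bicommutant property an algebra is determined by its commutant. This turns single
generation into a question about which operators commute. -/
theorem isGeneratedBy_iff {M : VonNeumannAlgebra H} {S : Set (H →L[ℂ] H)} :
    M.IsGeneratedBy S ↔
      Set.centralizer (M : Set (H →L[ℂ] H)) = Set.centralizer (S ∪ star S) := by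
  have hsub : ∀ N : VonNeumannAlgebra H, S ⊆ (N : Set (H →L[ℂ] H)) →
      S ∪ star S ⊆ (N : Set (H →L[ℂ] H)) := fun N hN x hx => hx.elim (fun h => hN h)
    fun h => by simpa using star_mem (s := N) (hN h)
  constructor
  · rintro ⟨h1, h2⟩
    refine (Set.centralizer_subset (hsub M h1)).antisymm ?_
    have h3 : (M : Set (H →L[ℂ] H)) ⊆ Set.centralizer (Set.centralizer (S ∪ star S)) := by
      rw [← coe_generatedBy]
      refine h2 _ ?_
      rw [coe_generatedBy]
      exact Set.subset_union_left.trans Set.subset_centralizer_centralizer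
    simpa using Set.centralizer_subset h3
  · intro h
    have hM : (M : Set (H →L[ℂ] H)) = Set.centralizer (Set.centralizer (S ∪ star S)) := by
      rw [← h, centralizer_centralizer]
    refine ⟨?_, fun N hN => ?_⟩
    · rw [hM]
      exact Set.subset_union_left.trans Set.subset_centralizer_centralizer
    · change (M : Set (H →L[ℂ] H)) ⊆ N
      rw [hM, ← centralizer_centralizer N]
      exact Set.centralizer_subset (Set.centralizer_subset (hsub N hN))

theorem centralizer_generatedBy (S : Set (H →L[ℂ] H)) :
    Set.centralizer (generatedBy S : Set (H →L[ℂ] H)) = Set.centralizer (S ∪ star S) := by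
  rw [coe_generatedBy, Set.centralizer_centralizer_centralizer]

end VonNeumannAlgebra

end Generation

/-! ### Compressions to closed subspaces -/

section Compression

variable {H : Type u} [NormedAddCommGroup H] [InnerProductSpace ℂ H]

/-- The compression of an operator to a closed subspace. -/
noncomputable def Submodule.compress (U : Submodule ℂ H) [U.HasOrthogonalProjection]
    (T : H →L[ℂ] H) : U →L[ℂ] U :=
  U.orthogonalProjectionOnto ∘L T ∘L U.subtypeL

theorem Submodule.coe_compress_apply {U : Submodule ℂ H} [U.HasOrthogonalProjection]
    {T : H →L[ℂ] H} {v : U} (h : T v ∈ U) : (U.compress T v : H) = T v :=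
  U.starProjection_eq_self_iff.2 h

theorem Submodule.star_compress [CompleteSpace H] (U : Submodule ℂ H) [CompleteSpace U]
    (T : H →L[ℂ] H) : star (U.compress T) = U.compress (star T) := by
  simp only [Submodule.compress, ContinuousLinearMap.star_eq_adjoint,
    ContinuousLinearMap.adjoint_comp, Submodule.adjoint_subtypeL,
    Submodule.adjoint_orthogonalProjectionOnto, ContinuousLinearMap.comp_assoc]

theorem Submodule.compress_mul {U : Submodule ℂ H} [U.HasOrthogonalProjection]
    {S T : H →L[ℂ] H} (hS : ∀ v ∈ U, S v ∈ U) (hT : ∀ v ∈ U, T v ∈ U) :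
    U.compress (S * T) = U.compress S * U.compress T := by
  ext v
  refine (Submodule.coe_compress_apply (show (S * T) v ∈ U from hS (T v) (hT v v.2))).trans (Eq.symm ?_)
  refine (Submodule.coe_compress_apply (hS _ (U.compress T v).2)).trans ?_
  rw [Submodule.coe_compress_apply (hT _ v.2)]
  rfl

end Compression

/-! ### Cyclic subspaces -/

section Cyclic

variable {H : Type u} [NormedAddCommGroup H] [InnerProductSpace ℂ H]

/-- The closed linear span of the vectors `T ξ` with `T ∈ A`. -/
def cyclicSubspace (A : Set (H →L[ℂ] H)) (ξ : H) : Submodule ℂ H :=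
  (Submodule.span ℂ ((fun T : H →L[ℂ] H => T ξ) '' A)).topologicalClosure

instance [CompleteSpace H] (A : Set (H →L[ℂ] H)) (ξ : H) : CompleteSpace (cyclicSubspace A ξ) :=
  (Submodule.isClosed_topologicalClosure _).completeSpace_coe

theorem apply_mem_cyclicSubspace {A : Set (H →L[ℂ] H)} {T : H →L[ℂ] H} (hT : T ∈ A) (ξ : H) :
    T ξ ∈ cyclicSubspace A ξ :=
  Submodule.le_topologicalClosure _ (Submodule.subset_span ⟨T, hT, rfl⟩)

theorem cyclicSubspace_le_of_forall_mem {A : Set (H →L[ℂ] H)} {ξ : H} {U : Submodule ℂ H}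
    (hU : IsClosed (U : Set H)) (h : ∀ T ∈ A, T ξ ∈ U) : cyclicSubspace A ξ ≤ U := by
  refine Submodule.topologicalClosure_minimal _ (Submodule.span_le.2 ?_) hU
  rintro _ ⟨T, hT, rfl⟩
  exact h T hT

theorem map_mem_cyclicSubspace {A : Set (H →L[ℂ] H)} {ξ : H} {X : H →L[ℂ] H}
    (h : ∀ T ∈ A, X * T ∈ A) {v : H} (hv : v ∈ cyclicSubspace A ξ) : X v ∈ cyclicSubspace A ξ := by
  have hle : cyclicSubspace A ξ ≤ (cyclicSubspace A ξ).comap (X : H →ₗ[ℂ] H) := by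
    refine cyclicSubspace_le_of_forall_mem ?_ fun T hT => ?_
    · exact (Submodule.isClosed_topologicalClosure _).preimage X.continuous
    · exact apply_mem_cyclicSubspace (h T hT) ξ
  exact hle hv

theorem isOrtho_cyclicSubspace_iff {A : Set (H →L[ℂ] H)} {ξ v : H} :
    v ∈ (cyclicSubspace A ξ)ᗮ ↔ ∀ T ∈ A, inner ℂ v (T ξ) = 0 := by
  constructor
  · intro h T hT
    exact Submodule.inner_left_of_mem_orthogonal (apply_mem_cyclicSubspace hT ξ) h
  · intro h
    rw [Submodule.mem_orthogonal']
    intro u hu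
    have : cyclicSubspace A ξ ≤ (ℂ ∙ v)ᗮ :=
      cyclicSubspace_le_of_forall_mem (Submodule.isClosed_orthogonal _) fun T hT =>
        Submodule.mem_orthogonal_singleton_iff_inner_right.2 (h T hT)
    exact Submodule.mem_orthogonal_singleton_iff_inner_right.1 (this hu)

theorem separableSpace_cyclicSubspace {A : Set (H →L[ℂ] H)} (hA : A.Countable) (ξ : H) :
    TopologicalSpace.SeparableSpace (cyclicSubspace A ξ) :=
  ((hA.image _).isSeparable.span (R := ℂ)).closure.separableSpace

/-- Every element is a finite word in `S`. Words replace the generated algebra because they stay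
countable and span the same cyclic subspaces. -/
theorem Submonoid.countable_closure {A : Type*} [Monoid A] {S : Set A} (hS : S.Countable) :
    (Submonoid.closure S : Set A).Countable := by
  have := hS.to_subtype
  have : Countable (FreeMonoid S) := inferInstanceAs (Countable (List S))
  rw [Submonoid.closure_eq_mrange, MonoidHom.coe_mrange]
  exact Set.countable_range _

end Cyclic

/-! ### A criterion for being separably acting -/

section SeparablyActing

variable {H : Type u} [NormedAddCommGroup H] [InnerProductSpace ℂ H]

/-- The functional given by square-summable sequences of vectors is `σ`-weakly continuous. -/
theorem continuous_sigmaWeakTopology_functional {ξ η : ℕ → H} (hξ : Summable fun n => ‖ξ n‖ ^ 2)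
    (hη : Summable fun n => ‖η n‖ ^ 2) :
    @Continuous _ _ (sigmaWeakTopology H) _
      fun T : H →L[ℂ] H => ∑' n, inner ℂ (η n) (T (ξ n)) := by
  refine continuous_iff_le_induced.2 ?_
  exact (iInf_le _ ξ).trans ((iInf_le _ η).trans ((iInf_le _ hξ).trans (iInf_le _ hη)))

theorem continuous_sigmaWeakTopology_iff {X : Type*} {_ : TopologicalSpace X} {f : X → H →L[ℂ] H} :
    @Continuous _ _ _ (sigmaWeakTopology H) f ↔ ∀ ξ η : ℕ → H,
      (Summable fun n => ‖ξ n‖ ^ 2) → (Summable fun n => ‖η n‖ ^ 2) →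
        Continuous fun x => ∑' n, inner ℂ (η n) (f x (ξ n)) := by
  simp only [continuous_iInf_rng, continuous_induced_rng]
  rfl

theorem Commute.apply_mem_of_starProjection {U : Submodule ℂ H} [U.HasOrthogonalProjection]
    {T : H →L[ℂ] H} (h : Commute T U.starProjection) {v : H} (hv : v ∈ U) : T v ∈ U := by
  have : T (U.starProjection v) = U.starProjection (T v) :=
    congrArg (fun X : H →L[ℂ] H => X v) h.eq
  rw [U.starProjection_eq_self_iff.2 hv] at this
  rw [this]
  exact U.starProjection_apply_mem _

variable [CompleteSpace H]

/-- The subspace is invariant under each `X ∈ S` and under its adjoint, again in `S`, hence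
reducing. -/
theorem commute_starProjection_cyclicSubspace {A S : Set (H →L[ℂ] H)} (hS : star S = S)
    (h : ∀ X ∈ S, ∀ T ∈ A, X * T ∈ A) (ξ : H) :
    (cyclicSubspace A ξ).starProjection ∈ Set.centralizer S := by
  intro X hX
  refine Submodule.commute_starProjection_of_invariant (fun v hv => ?_) fun v hv => ?_
  · exact map_mem_cyclicSubspace (h X hX) hv
  · exact map_mem_cyclicSubspace (h _ (by rw [← hS, Set.star_mem_star]; exact hX)) hv

/-- A countably generated von Neumann algebra with a vector that is cyclic for the algebra
together with its commutant is separably acting. -/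
theorem VonNeumannAlgebra.isSeparablyActing_of_total {M : VonNeumannAlgebra H}
    {S : Set (H →L[ℂ] H)} (hSc : S.Countable) (hS : star S = S)
    (hM : Set.centralizer (M : Set (H →L[ℂ] H)) = Set.centralizer S) (ξ : H)
    (hξ : ∀ v, (∀ R ∈ Set.centralizer S, ∀ w ∈ Submonoid.closure S, inner ℂ v (R (w ξ)) = 0) →
      v = 0) : M.IsSeparablyActing := by
  set K : Submodule ℂ H := cyclicSubspace (Submonoid.closure S : Set (H →L[ℂ] H)) ξ with hK
  have hsep : TopologicalSpace.SeparableSpace K :=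
    separableSpace_cyclicSubspace (Submonoid.countable_closure hSc) ξ
  have hP : K.starProjection ∈ Set.centralizer (M : Set (H →L[ℂ] H)) := by
    rw [hM]
    exact commute_starProjection_cyclicSubspace hS
      (fun X hX T hT => mul_mem (Submonoid.subset_closure hX) hT) ξ
  have hinv : ∀ T ∈ M, ∀ v ∈ K, T v ∈ K := fun T hT v hv =>
    Commute.apply_mem_of_starProjection (hP T hT) hv
  let π : M.toStarSubalgebra →⋆ₐ[ℂ] (K →L[ℂ] K) :=
    { toFun := fun T => K.compress T
      map_one' := by
        ext v
        rw [Submodule.coe_compress_apply]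
        · rfl
        · exact v.2
      map_mul' := fun S T => Submodule.compress_mul (hinv S S.2) (hinv T T.2)
      map_zero' := by
        ext v
        simp [Submodule.compress]
      map_add' := fun S T => by
        ext v
        simp [Submodule.compress]
      commutes' := fun r => by
        ext v
        rw [Submodule.coe_compress_apply]
        · rfl
        · exact K.smul_mem r v.2
      map_star' := fun T => (K.star_compress T).symm }
  have hπ : ∀ (T : M.toStarSubalgebra) (v : K), (π T v : H) = T.1 v := fun T v =>
    Submodule.coe_compress_apply (hinv T T.2 v v.2)
  refine ⟨K, inferInstance, inferInstance, inferInstance, hsep, π, ?_, ?_⟩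
  · refine (injective_iff_map_eq_zero π).2 fun T hT => ?_
    -- `T` kills every `w ξ`, hence every `R (w ξ)` because it commutes with `R`; so the range of
    -- `star T` is orthogonal to a total set.
    have hz : ∀ v, star T.1 v = 0 := by
      intro v
      refine hξ _ fun R hR w hw => ?_
      rw [← hM] at hR
      have h1 : T.1 (w ξ) = 0 := by
        have := hπ T ⟨w ξ, apply_mem_cyclicSubspace hw ξ⟩
        rw [hT] at this
        exact this.symm
      have h2 : T.1 (R (w ξ)) = R (T.1 (w ξ)) :=
        congrArg (fun X : H →L[ℂ] H => X (w ξ)) (hR T.1 T.2)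
      rw [ContinuousLinearMap.star_eq_adjoint, ContinuousLinearMap.adjoint_inner_left, h2, h1,
        map_zero, inner_zero_right]
    have : star T.1 = 0 := ContinuousLinearMap.ext hz
    exact Subtype.ext (star_eq_zero.1 this)
  · refine continuous_sigmaWeakTopology_iff.2 fun x y hx hy => ?_
    -- Sequences in `K` are also sequences in `H`, so `σ`-weak functionals pull back to `σ`-weak
    -- functionals.
    have h1 : ∀ T : M.toStarSubalgebra, ∑' n, inner ℂ (y n) (π T (x n)) =
        ∑' n, inner ℂ (y n : H) (T.1 (x n)) := fun T => tsum_congr fun n => by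
      rw [Submodule.coe_inner, hπ]
    simp only [h1]
    exact @Continuous.comp _ _ _ (_) (sigmaWeakTopology H) _ _ _
      (continuous_sigmaWeakTopology_functional (ξ := fun n => (x n : H))
        (η := fun n => (y n : H)) hx hy)
      (@continuous_induced_dom M.toStarSubalgebra _ Subtype.val (sigmaWeakTopology H))

end SeparablyActing

/-! ### Orthogonal decomposition into central subspaces -/

section Decomposition

variable {H : Type u} [NormedAddCommGroup H] [InnerProductSpace ℂ H]

/-- The closed linear span of the vectors `R w ξ`, where `R` commutes with `S` and `w` is a product
of elements of `S`. -/
def centralSubspace (S : Set (H →L[ℂ] H)) (ξ : H) : Submodule ℂ H :=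
  cyclicSubspace {X | ∃ R ∈ Set.centralizer S, ∃ w ∈ Submonoid.closure S, X = R * w} ξ

theorem apply_mem_centralSubspace {S : Set (H →L[ℂ] H)} {R w : H →L[ℂ] H}
    (hR : R ∈ Set.centralizer S) (hw : w ∈ Submonoid.closure S) (ξ : H) :
    R (w ξ) ∈ centralSubspace S ξ :=
  apply_mem_cyclicSubspace
    (A := {X | ∃ R ∈ Set.centralizer S, ∃ w ∈ Submonoid.closure S, X = R * w})
    (T := R * w) ⟨R, hR, w, hw, rfl⟩ ξ

theorem self_mem_centralSubspace (S : Set (H →L[ℂ] H)) (ξ : H) : ξ ∈ centralSubspace S ξ :=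
  apply_mem_centralSubspace (R := 1) (w := 1) Set.one_mem_centralizer (one_mem _) ξ

theorem map_mem_centralSubspace {S : Set (H →L[ℂ] H)} {X : H →L[ℂ] H} (hX : X ∈ S) {ξ v : H}
    (hv : v ∈ centralSubspace S ξ) : X v ∈ centralSubspace S ξ := by
  refine map_mem_cyclicSubspace ?_ hv
  rintro _ ⟨R, hR, w, hw, rfl⟩
  refine ⟨R, hR, X * w, mul_mem (Submonoid.subset_closure hX) hw, ?_⟩
  rw [← mul_assoc, hR X hX, mul_assoc]

theorem map_mem_centralSubspace_of_mem_centralizer {S : Set (H →L[ℂ] H)} {X : H →L[ℂ] H}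
    (hX : X ∈ Set.centralizer S) {ξ v : H}
    (hv : v ∈ centralSubspace S ξ) : X v ∈ centralSubspace S ξ := by
  refine map_mem_cyclicSubspace ?_ hv
  rintro _ ⟨R, hR, w, hw, rfl⟩
  exact ⟨X * R, Set.mul_mem_centralizer hX hR, w, hw, (mul_assoc _ _ _).symm⟩

theorem map_mem_centralSubspace_of_mem_closure {S : Set (H →L[ℂ] H)} {w : H →L[ℂ] H}
    (hw : w ∈ Submonoid.closure S) {ξ v : H}
    (hv : v ∈ centralSubspace S ξ) : w v ∈ centralSubspace S ξ := by
  induction hw using Submonoid.closure_induction generalizing v with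
  | mem x hx => exact map_mem_centralSubspace hx hv
  | one => exact hv
  | mul x y _ _ hx hy => exact hx (hy hv)

variable [CompleteSpace H]

instance (S : Set (H →L[ℂ] H)) (ξ : H) : CompleteSpace (centralSubspace S ξ) :=
  inferInstanceAs (CompleteSpace (cyclicSubspace _ ξ))

theorem star_mem_centralizer_of_star_eq {S : Set (H →L[ℂ] H)} (hS : star S = S) {R : H →L[ℂ] H}
    (hR : R ∈ Set.centralizer S) : star R ∈ Set.centralizer S := by
  intro X hX
  have := hR (star X) (by rw [← hS, Set.star_mem_star]; exact hX)
  simpa using (congrArg star this).symm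

/-- The projection `P` onto `centralSubspace S ξ` commutes with the words and with the commutant of
`S`, so `P v = 0` forces `P (R (w v)) = 0`. -/
theorem isOrtho_centralSubspace {S : Set (H →L[ℂ] H)} (hS : star S = S) {ξ v : H}
    (hv : v ∈ (centralSubspace S ξ)ᗮ) : centralSubspace S v ⟂ centralSubspace S ξ := by
  set P := (centralSubspace S ξ).starProjection with hP
  have hPS : ∀ X ∈ S, Commute X P := fun X hX =>
    Submodule.commute_starProjection_of_invariant (fun u hu => map_mem_centralSubspace hX hu)
      fun u hu => map_mem_centralSubspace (by rw [← hS, Set.star_mem_star]; exact hX) hu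
  have hPR : ∀ R ∈ Set.centralizer S, Commute R P := fun R hR =>
    Submodule.commute_starProjection_of_invariant
      (fun u hu => map_mem_centralSubspace_of_mem_centralizer hR hu)
      fun u hu => map_mem_centralSubspace_of_mem_centralizer
        (star_mem_centralizer_of_star_eq hS hR) hu
  have hPw : ∀ w ∈ Submonoid.closure S, Commute w P := by
    intro w hw
    induction hw using Submonoid.closure_induction with
    | mem x hx => exact hPS x hx
    | one => exact .one_left _
    | mul x y _ _ hx hy => exact hx.mul_left hy
  refine cyclicSubspace_le_of_forall_mem (Submodule.isClosed_orthogonal _) ?_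
  rintro _ ⟨R, hR, w, hw, rfl⟩
  rw [← Submodule.starProjection_apply_eq_zero_iff] at hv ⊢
  have : (R * w) (P v) = P ((R * w) v) :=
    congrArg (fun X : H →L[ℂ] H => X v) ((hPR R hR).mul_left (hPw w hw)).eq
  rw [hv, map_zero] at this
  exact this.symm

/-- Zorn's lemma: a nonzero vector orthogonal to all chosen subspaces could be adjoined, by
`isOrtho_centralSubspace`. -/
theorem exists_maximal_centralSubspace_family {S : Set (H →L[ℂ] H)} (hS : star S = S) :
    ∃ I : Set H, (∀ ξ ∈ I, ξ ≠ 0) ∧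
      I.Pairwise (fun ξ η => centralSubspace S ξ ⟂ centralSubspace S η) ∧
      ∀ v, (∀ ξ ∈ I, v ∈ (centralSubspace S ξ)ᗮ) → v = 0 := by
  obtain ⟨I, hI⟩ := zorn_subset {I : Set H | (∀ ξ ∈ I, ξ ≠ 0) ∧
      I.Pairwise (fun ξ η => centralSubspace S ξ ⟂ centralSubspace S η)} (by
    intro c hc hchain
    refine ⟨⋃₀ c, ⟨?_, ?_⟩, fun s hs => Set.subset_sUnion_of_mem hs⟩
    · rintro ξ ⟨s, hs, hξ⟩
      exact (hc hs).1 ξ hξ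
    · exact (Set.pairwise_sUnion hchain.directedOn).2 fun s hs => (hc hs).2)
  refine ⟨I, hI.1.1, hI.1.2, fun v hv => ?_⟩
  by_contra hne
  have hmem : insert v I ∈ {I : Set H | (∀ ξ ∈ I, ξ ≠ 0) ∧
      I.Pairwise (fun ξ η => centralSubspace S ξ ⟂ centralSubspace S η)} := by
    refine ⟨?_, ?_⟩
    · rintro ξ (rfl | hξ)
      · exact hne
      · exact hI.1.1 ξ hξ
    · refine hI.1.2.insert fun ξ hξ _ => ?_
      have := isOrtho_centralSubspace hS (hv ξ hξ)
      exact ⟨this, this.symm⟩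
  have hvI : v ∈ I := hI.2 hmem (Set.subset_insert v I) (Set.mem_insert v I)
  exact hne (inner_self_eq_zero.1
    (Submodule.inner_right_of_mem_orthogonal (self_mem_centralSubspace S v) (hv v hvI)))

/-- Vectors with orthogonal central subspaces are separated by their vector functionals. -/
theorem eq_zero_of_forall_inner_eq {S : Set (H →L[ℂ] H)} (hS : star S = S) {ξ η : H}
    (hort : centralSubspace S ξ ⟂ centralSubspace S η)
    (h : ∀ w ∈ Submonoid.closure S, (inner ℂ ξ (w ξ) : ℂ) = inner ℂ η (w η)) : η = 0 := by
  set K := cyclicSubspace (Submonoid.closure S : Set (H →L[ℂ] H)) (ξ + η) with hK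
  have hP : K.starProjection ∈ Set.centralizer S :=
    commute_starProjection_cyclicSubspace hS
      (fun X hX T hT => mul_mem (Submonoid.subset_closure hX) hT) _
  have hsum : ξ + η ∈ K := apply_mem_cyclicSubspace (T := 1) (one_mem (Submonoid.closure S)) _
  -- The cross terms vanish, so `⟪ξ - η, w (ξ + η)⟫ = ⟪ξ, w ξ⟫ - ⟪η, w η⟫ = 0`.
  have hdiff : ξ - η ∈ Kᗮ := by
    rw [isOrtho_cyclicSubspace_iff]
    intro w hw
    have h1 : inner ℂ ξ (w η) = 0 := hort.inner_eq (self_mem_centralSubspace S ξ)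
      (map_mem_centralSubspace_of_mem_closure hw (self_mem_centralSubspace S η))
    have h2 : inner ℂ η (w ξ) = 0 := hort.symm.inner_eq (self_mem_centralSubspace S η)
      (map_mem_centralSubspace_of_mem_closure hw (self_mem_centralSubspace S ξ))
    rw [map_add, inner_sub_left, inner_add_right, inner_add_right, h1, h2, h w hw]
    ring
  -- This projection is in the commutant of `S` and so preserves `centralSubspace S ξ`. It therefore
  -- drags `η` into that subspace, to which `η` is also orthogonal.
  have h1 : K.starProjection (ξ + ξ) = ξ + η := by
    have : ξ + ξ = (ξ + η) + (ξ - η) := by abel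
    rw [this, map_add, K.starProjection_eq_self_iff.2 hsum,
      K.starProjection_apply_eq_zero_iff.2 hdiff, add_zero]
  have hξ := self_mem_centralSubspace S ξ
  have h2 : ξ + η ∈ centralSubspace S ξ := by
    rw [← h1]
    exact map_mem_centralSubspace_of_mem_centralizer hP (add_mem hξ hξ)
  have h3 : η ∈ centralSubspace S ξ := by simpa using sub_mem h2 hξ
  exact inner_self_eq_zero.1 (hort.inner_eq h3 (self_mem_centralSubspace S η))

end Decomposition

/-! ### Direct sums of operators and separating projections -/

section DirectSum

variable {H : Type u} [NormedAddCommGroup H] [InnerProductSpace ℂ H] [CompleteSpace H]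
  {ι : Type*} {F : ι → Submodule ℂ H}

/-- The range of the adjoint of `X - Y` is orthogonal to every `F i`. -/
theorem ContinuousLinearMap.ext_of_total (htot : ∀ v, (∀ i, v ∈ (F i)ᗮ) → v = 0)
    {X Y : H →L[ℂ] H} (h : ∀ i, ∀ v ∈ F i, X v = Y v) : X = Y := by
  have hz : ∀ u, star (X - Y) u = 0 := by
    refine fun u => htot _ fun i v hv => ?_
    rw [star_eq_adjoint, adjoint_inner_right, sub_apply, h i v hv, sub_self, inner_zero_left]
  exact sub_eq_zero.1 (star_eq_zero.1 (ContinuousLinearMap.ext hz))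

variable [∀ i, CompleteSpace (F i)]

/-- The direct sum of a family of contractions on mutually orthogonal subspaces. -/
theorem exists_directSum_of_contractions
    (hF : Pairwise fun i j => F i ⟂ F j) (htot : ∀ v, (∀ i, v ∈ (F i)ᗮ) → v = 0)
    (y : ∀ i, F i →L[ℂ] F i) (hy : ∀ i, ‖y i‖ ≤ 1) :
    ∃ Y : H →L[ℂ] H, ∀ i (v : F i), Y v = y i v := by
  classical
  have hsum : IsHilbertSum ℂ (fun i => F i) fun i => (F i).subtypeₗᵢ := by
    refine IsHilbertSum.mkInternal F (OrthogonalFamily.of_pairwise hF) (top_le_iff.2 ?_)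
    rw [Submodule.topologicalClosure_eq_top_iff, eq_bot_iff]
    intro v hv
    exact htot v fun i => Submodule.orthogonal_le (le_iSup F i) hv
  let e := hsum.linearIsometryEquiv
  have hle : ∀ (f : lp (fun i => F i) 2) i, ‖y i (f i)‖ ≤ ‖f i‖ := fun f i =>
    ((y i).le_opNorm _).trans (mul_le_of_le_one_left (norm_nonneg _) (hy i))
  have hmem : ∀ f : lp (fun i => F i) 2, Memℓp (fun i => y i (f i)) 2 := fun f =>
    (lp.memℓp f).mono' (hle f)
  -- The uniform bound on the `y i` makes the coordinatewise action bounded on the `ℓ²` sum.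
  let D : lp (fun i => F i) 2 →L[ℂ] lp (fun i => F i) 2 := LinearMap.mkContinuous
    { toFun := fun f => ⟨fun i => y i (f i), hmem f⟩
      map_add' := fun f g => Subtype.ext (funext fun i => map_add (y i) (f i) (g i))
      map_smul' := fun c f => Subtype.ext (funext fun i => map_smul (y i) c (f i)) } 1 (fun f => by
      rw [one_mul]
      exact lp.norm_mono (by simp) (hle f))
  have hD : ∀ f i, D f i = y i (f i) := fun f i => rfl
  refine ⟨e.symm.toContinuousLinearEquiv.toContinuousLinearMap ∘L D ∘L
    e.toContinuousLinearEquiv.toContinuousLinearMap, fun i v => ?_⟩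
  change e.symm (D (e v)) = _
  have h1 : e v = lp.single 2 i v := by
    rw [← e.symm.injective.eq_iff, e.symm_apply_apply]
    exact (hsum.linearIsometryEquiv_symm_apply_single v).symm
  have h2 : D (lp.single 2 i v) = lp.single 2 i (y i v) := by
    ext j
    rw [hD, lp.single_apply, lp.single_apply]
    by_cases hij : j = i
    · subst hij
      simp
    · simp [hij]
  rw [h1, h2]
  exact hsum.linearIsometryEquiv_symm_apply_single _

theorem star_apply_of_forall_apply
    (hF : Pairwise fun i j => F i ⟂ F j) (htot : ∀ v, (∀ i, v ∈ (F i)ᗮ) → v = 0)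
    {y : ∀ i, F i →L[ℂ] F i} {Y : H →L[ℂ] H} (hY : ∀ i (v : F i), Y v = y i v) (i : ι) (v : F i) :
    star Y v = star (y i) v := by
  refine sub_eq_zero.1 (htot _ fun j u hu => ?_)
  rw [inner_sub_right, ContinuousLinearMap.star_eq_adjoint,
    ContinuousLinearMap.adjoint_inner_right, hY j ⟨u, hu⟩]
  by_cases hij : j = i
  · subst hij
    rw [← Submodule.coe_inner, ContinuousLinearMap.star_eq_adjoint,
      show (inner ℂ u ((ContinuousLinearMap.adjoint (y j) v : F j) : H)) =
        inner ℂ (⟨u, hu⟩ : F j) (ContinuousLinearMap.adjoint (y j) v) from rfl,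
      ContinuousLinearMap.adjoint_inner_right, sub_self]
  · rw [(hF hij).inner_eq (y j ⟨u, hu⟩).2 v.2, (hF hij).inner_eq hu (star (y i) v).2, sub_zero]

end DirectSum

section DirectSum

variable {H : Type u} [NormedAddCommGroup H] [InnerProductSpace ℂ H] [CompleteSpace H]
  {ι : Type*} {F : ι → Submodule ℂ H}

theorem commute_of_invariant_of_bool (htot : ∀ v, (∀ i, v ∈ (F i)ᗮ) → v = 0) {q : ι → Bool}
    {Q : H →L[ℂ] H} (hQ : ∀ i, ∀ v ∈ F i, Q v = if q i then v else 0) {X : H →L[ℂ] H}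
    (hX : ∀ i, ∀ v ∈ F i, X v ∈ F i) : Commute Q X := by
  refine ContinuousLinearMap.ext_of_total htot fun i v hv => ?_
  change Q (X v) = X (Q v)
  rw [hQ i _ (hX i v hv), hQ i v hv]
  split_ifs
  · rfl
  · rw [map_zero]

variable [∀ i, CompleteSpace (F i)]

/-- Operators that leave all summands invariant commute if and only if their compressions do. -/
theorem commute_iff_forall_commute_compress (htot : ∀ v, (∀ i, v ∈ (F i)ᗮ) → v = 0)
    {T X : H →L[ℂ] H} (hT : ∀ i, ∀ v ∈ F i, T v ∈ F i) (hX : ∀ i, ∀ v ∈ F i, X v ∈ F i) :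
    Commute T X ↔ ∀ i, Commute ((F i).compress T) ((F i).compress X) := by
  refine ⟨fun h i => ?_, fun h => ?_⟩
  · change _ * _ = _ * _
    rw [← Submodule.compress_mul (hT i) (hX i), ← Submodule.compress_mul (hX i) (hT i), h.eq]
  · refine ContinuousLinearMap.ext_of_total htot fun i v hv => ?_
    have h1 := (h i).eq
    rw [← Submodule.compress_mul (hT i) (hX i), ← Submodule.compress_mul (hX i) (hT i)] at h1
    have h2 := congrArg (fun Z : F i →L[ℂ] F i => (Z ⟨v, hv⟩ : H)) h1
    exact (Submodule.coe_compress_apply (show (T * X) v ∈ F i from hT i _ (hX i v hv))).symm.trans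
      (h2.trans (Submodule.coe_compress_apply (show (X * T) v ∈ F i from hX i _ (hT i v hv))))

theorem exists_projections_of_bool (hF : Pairwise fun i j => F i ⟂ F j)
    (htot : ∀ v, (∀ i, v ∈ (F i)ᗮ) → v = 0) (q : ι → Bool) :
    ∃ Q : H →L[ℂ] H, IsStarProjection Q ∧ ∀ i, ∀ v ∈ F i, Q v = if q i then v else 0 := by
  obtain ⟨Q, hQ⟩ := exists_directSum_of_contractions hF htot
    (fun i => if q i then (1 : F i →L[ℂ] F i) else 0) fun i => by
      split_ifs
      · exact ContinuousLinearMap.norm_id_le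
      · exact (norm_zero (E := F i →L[ℂ] F i)).trans_le zero_le_one
  have hQ' : ∀ i, ∀ v ∈ F i, Q v = if q i then v else 0 := by
    intro i v hv
    rw [hQ i ⟨v, hv⟩]
    split_ifs <;> rfl
  refine ⟨Q, ⟨?_, ?_⟩, hQ'⟩
  · refine ContinuousLinearMap.ext_of_total htot fun i v hv => ?_
    change Q (Q v) = Q v
    rw [hQ' i v hv]
    split_ifs with h
    · rw [hQ' i v hv, if_pos h]
    · rw [map_zero]
  · refine ContinuousLinearMap.ext_of_total htot fun i v hv => ?_
    rw [star_apply_of_forall_apply hF htot hQ i ⟨v, hv⟩, hQ' i v hv]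
    split_ifs
    · exact congrArg (fun Z : F i →L[ℂ] F i => (Z ⟨v, hv⟩ : H)) (star_one (F i →L[ℂ] F i))
    · exact congrArg (fun Z : F i →L[ℂ] F i => (Z ⟨v, hv⟩ : H)) (star_zero (F i →L[ℂ] F i))

/-- An operator commuting with projections that separate the summands leaves them invariant. -/
theorem apply_mem_of_commute_separating (hF : Pairwise fun i j => F i ⟂ F j)
    (htot : ∀ v, (∀ i, v ∈ (F i)ᗮ) → v = 0) {q : ι → ℕ → Bool} (hq : Function.Injective q)
    {Q : ℕ → H →L[ℂ] H} (hQs : ∀ n, IsSelfAdjoint (Q n))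
    (hQ : ∀ n i, ∀ v ∈ F i, Q n v = if q i n then v else 0) {T : H →L[ℂ] H}
    (hT : ∀ n, Commute T (Q n)) (i : ι) (v : H) (hv : v ∈ F i) : T v ∈ F i := by
  have hsub : T v - (F i).starProjection (T v) = 0 := by
    refine htot _ fun j u hu => ?_
    by_cases hij : i = j
    · subst hij
      exact (F i).sub_starProjection_mem_orthogonal (T v) u hu
    · rw [inner_sub_right, (hF hij).symm.inner_eq hu ((F i).starProjection_apply_mem _), sub_zero]
      -- `Q n` is the identity on one of `F i`, `F j` and zero on the other; moving it across the
      -- inner product gives `⟪u, T v⟫ = 0`.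
      obtain ⟨n, hn⟩ := Function.ne_iff.1 (hq.ne hij)
      have e1 : T (Q n v) = Q n (T v) := congrArg (fun X : H →L[ℂ] H => X v) (hT n).eq
      have e2 : (inner ℂ (Q n u) (T v) : ℂ) = inner ℂ u (T (Q n v)) := by
        rw [e1, ← ContinuousLinearMap.adjoint_inner_left (Q n),
          ← ContinuousLinearMap.star_eq_adjoint, (hQs n).star_eq]
      rw [hQ n i v hv, hQ n j u hu] at e2
      cases hi : q i n <;> cases hj : q j n
      · exact absurd (hi.trans hj.symm) hn
      · simpa [hi, hj] using e2
      · simpa [hi, hj] using e2.symm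
      · exact absurd (hi.trans hj.symm) hn
  rw [sub_eq_zero.1 hsub]
  exact (F i).starProjection_apply_mem _

end DirectSum

/-! ### From countably many generators to one -/

section Reduction

variable {H : Type u} [NormedAddCommGroup H] [InnerProductSpace ℂ H] [CompleteSpace H]

theorem VonNeumannAlgebra.isGeneratedBy_singleton_iff {M : VonNeumannAlgebra H} {x : H →L[ℂ] H} :
    M.IsGeneratedBy {x} ↔ ∀ t, t ∈ Set.centralizer (M : Set (H →L[ℂ] H)) ↔
      Commute t x ∧ Commute t (star x) := by
  rw [isGeneratedBy_iff, Set.ext_iff]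
  refine forall_congr' fun t => iff_congr Iff.rfl ?_
  rw [Set.star_singleton, Set.mem_centralizer_iff]
  refine ⟨fun h => ⟨(h x (.inl rfl)).symm, (h _ (.inr rfl)).symm⟩, ?_⟩
  rintro ⟨h1, h2⟩ _ (rfl | rfl)
  · exact h1.symm
  · exact h2.symm

/-- Nonzero scaling preserves commutants; the uniform norm bound allows direct sums over arbitrary
families. -/
theorem exists_contraction_commute_iff {A : Type*} [CStarAlgebra A] (y : A) :
    ∃ z : A, ‖z‖ ≤ 1 ∧ ∀ t, (Commute t z ∧ Commute t (star z)) ↔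
      Commute t y ∧ Commute t (star y) := by
  have hpos : 0 < ‖y‖ + 1 := by positivity
  have hscale : ∀ t z : A, Commute t ((‖y‖ + 1)⁻¹ • z) ↔ Commute t z := by
    refine fun t z => ⟨fun h => ?_, fun h => h.smul_right _⟩
    have := h.smul_right (‖y‖ + 1)
    rwa [smul_smul, mul_inv_cancel₀ hpos.ne', one_smul] at this
  refine ⟨(‖y‖ + 1)⁻¹ • y, ?_, fun t => ?_⟩
  · rw [norm_smul, Real.norm_of_nonneg (by positivity), inv_mul_le_one₀ hpos]
    linarith
  · rw [star_smul, star_trivial, hscale, hscale]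

/-- If separably acting von Neumann algebras are singly generated, then the compression of a
countable set of operators to a central subspace has the same commutant as one contraction. -/
theorem exists_contraction_centralizer_compress
    (hsa : ∀ (K : Type u) [NormedAddCommGroup K] [InnerProductSpace ℂ K] [CompleteSpace K]
      (N : VonNeumannAlgebra K), N.IsSeparablyActing → N.IsSinglyGenerated)
    {S : Set (H →L[ℂ] H)} (hSc : S.Countable) (hS : star S = S) (ξ : H) :
    ∃ y : centralSubspace S ξ →L[ℂ] centralSubspace S ξ, ‖y‖ ≤ 1 ∧
      ∀ t, (∀ X ∈ S, Commute t ((centralSubspace S ξ).compress X)) ↔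
        Commute t y ∧ Commute t (star y) := by
  set Z := centralSubspace S ξ with hZ
  set S' : Set (Z →L[ℂ] Z) := Z.compress '' S with hS'
  have hS'star : star S' = S' := by
    ext X
    rw [Set.mem_star]
    constructor
    · rintro ⟨Y, hY, h⟩
      refine ⟨star Y, by rw [← hS, Set.star_mem_star]; exact hY, ?_⟩
      rw [← Submodule.star_compress, h, star_star]
    · rintro ⟨Y, hY, rfl⟩
      refine ⟨star Y, by rw [← hS, Set.star_mem_star]; exact hY, ?_⟩
      rw [← Submodule.star_compress]
  have hcent : Set.centralizer (VonNeumannAlgebra.generatedBy S' : Set (Z →L[ℂ] Z)) =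
      Set.centralizer S' := by
    rw [VonNeumannAlgebra.centralizer_generatedBy, hS'star, Set.union_self]
  have hmapS : ∀ X ∈ S, ∀ v ∈ Z, X v ∈ Z := fun X hX v hv => map_mem_centralSubspace hX hv
  have hmapR : ∀ R ∈ Set.centralizer S, ∀ v ∈ Z, R v ∈ Z := fun R hR v hv =>
    map_mem_centralSubspace_of_mem_centralizer hR hv
  have hmapw : ∀ w ∈ Submonoid.closure S, ∀ v ∈ Z, w v ∈ Z := fun w hw v hv =>
    map_mem_centralSubspace_of_mem_closure hw hv
  -- This inclusion suffices: compressed commutant elements and compressed words already make `ξ`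
  -- total in `Z`.
  have hR : ∀ R ∈ Set.centralizer S, Z.compress R ∈ Set.centralizer S' := by
    rintro R hR _ ⟨X, hX, rfl⟩
    rw [← Submodule.compress_mul (hmapS X hX) (hmapR R hR),
      ← Submodule.compress_mul (hmapR R hR) (hmapS X hX), hR X hX]
  have hw : ∀ w ∈ Submonoid.closure S, Z.compress w ∈ Submonoid.closure S' := by
    intro w hw
    induction hw using Submonoid.closure_induction with
    | mem x hx => exact Submonoid.subset_closure ⟨x, hx, rfl⟩
    | one =>
      have : Z.compress 1 = 1 := by
        ext v
        exact Submodule.coe_compress_apply v.2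
      rw [this]
      exact one_mem _
    | mul x y hx hy ihx ihy =>
      rw [Submodule.compress_mul (hmapw x hx) (hmapw y hy)]
      exact mul_mem ihx ihy
  have hξZ : ξ ∈ Z := self_mem_centralSubspace S ξ
  have hsep : (VonNeumannAlgebra.generatedBy S').IsSeparablyActing := by
    refine VonNeumannAlgebra.isSeparablyActing_of_total (hSc.image _) hS'star hcent ⟨ξ, hξZ⟩
      fun v hv => ?_
    have hvo : (v : H) ∈ Zᗮ := by
      refine isOrtho_cyclicSubspace_iff.2 ?_
      rintro _ ⟨R, hR', w, hw', rfl⟩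
      have := hv _ (hR R hR') _ (hw w hw')
      rw [Submodule.coe_inner, Submodule.coe_compress_apply (hmapR R hR' _ (Z.compress w _).2),
        Submodule.coe_compress_apply (hmapw w hw' _ hξZ)] at this
      exact this
    exact Subtype.ext (inner_self_eq_zero.1 (Submodule.inner_right_of_mem_orthogonal v.2 hvo))
  obtain ⟨y, hy⟩ := hsa Z _ hsep
  rw [VonNeumannAlgebra.isGeneratedBy_singleton_iff] at hy
  obtain ⟨z, hz1, hz2⟩ := exists_contraction_commute_iff y
  refine ⟨z, hz1, fun t => ?_⟩
  rw [hz2, ← hy, hcent, hS', Set.mem_centralizer_iff, Set.forall_mem_image]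
  exact forall₂_congr fun X _ => ⟨fun h => h.symm, fun h => h.symm⟩

/-- Complex sequences and binary sequences both have the cardinality of the continuum. -/
theorem exists_injective_nat_bool_of_injective_nat_complex {ι : Type*} {f : ι → ℕ → ℂ}
    (hf : Function.Injective f) : ∃ q : ι → ℕ → Bool, Function.Injective q := by
  have : Nonempty ((ℕ → ℂ) ≃ (ℕ → Bool)) := by
    rw [← Cardinal.eq]
    simp
  obtain ⟨e⟩ := this
  exact ⟨e ∘ f, e.injective.comp hf⟩

/-- If separably acting von Neumann algebras are singly generated, then so are countably generated
ones. -/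
theorem VonNeumannAlgebra.IsCountablyGenerated.isSinglyGenerated
    (hsa : ∀ (K : Type u) [NormedAddCommGroup K] [InnerProductSpace ℂ K] [CompleteSpace K]
      (N : VonNeumannAlgebra K), N.IsSeparablyActing → N.IsSinglyGenerated)
    {M : VonNeumannAlgebra H} (hM : M.IsCountablyGenerated) : M.IsSinglyGenerated := by
  obtain ⟨S₀, hS₀c, hgen⟩ := hM
  rw [isGeneratedBy_iff] at hgen
  set S := S₀ ∪ star S₀ with hSdef
  have hS : star S = S := by rw [hSdef, Set.union_star, star_star, Set.union_comm]
  have hSc : S.Countable := hS₀c.union (by rw [← Set.image_star]; exact hS₀c.image _)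
  obtain ⟨I, hI0, hIpair, htot'⟩ := exists_maximal_centralSubspace_family hS
  let F : I → Submodule ℂ H := fun ξ => centralSubspace S ξ.1
  have hF : Pairwise fun i j => F i ⟂ F j := fun i j hij =>
    hIpair i.2 j.2 (Subtype.coe_injective.ne hij)
  have htot : ∀ v, (∀ i, v ∈ (F i)ᗮ) → v = 0 := fun v hv => htot' v fun ξ hξ => hv ⟨ξ, hξ⟩
  have hcompl : ∀ i, CompleteSpace (F i) := fun i => inferInstance
  -- the vector functionals separate the summands
  obtain ⟨W, hW⟩ := (Submonoid.countable_closure hSc).exists_eq_range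
    ⟨1, one_mem (Submonoid.closure S)⟩
  have hinj : Function.Injective fun (i : I) (n : ℕ) => (inner ℂ i.1 (W n i.1) : ℂ) := by
    intro i j hij
    by_contra hne
    refine hI0 j.1 j.2 (eq_zero_of_forall_inner_eq hS (hF hne) fun w hw => ?_)
    have hw' : w ∈ Set.range W := by rw [← hW]; exact hw
    obtain ⟨n, rfl⟩ := hw'
    exact congrFun hij n
  obtain ⟨q, hq⟩ := exists_injective_nat_bool_of_injective_nat_complex hinj
  choose y hy1 hy2 using fun i : I => exists_contraction_centralizer_compress hsa hSc hS i.1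
  obtain ⟨Y, hY⟩ := exists_directSum_of_contractions hF htot y hy1
  have hYs := star_apply_of_forall_apply hF htot hY
  choose Q hQproj hQ using fun n => exists_projections_of_bool hF htot fun i => q i n
  have hQinv : ∀ n i, ∀ v ∈ F i, Q n v ∈ F i := by
    intro n i v hv
    rw [hQ n i v hv]
    split_ifs
    · exact hv
    · exact zero_mem _
  have hQcomm : ∀ n (X : H →L[ℂ] H), (∀ i, ∀ v ∈ F i, X v ∈ F i) → Commute (Q n) X :=
    fun n X hX => commute_of_invariant_of_bool htot (hQ n) hX
  have hYinv : ∀ i, ∀ v ∈ F i, Y v ∈ F i := by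
    intro i v hv
    rw [hY i ⟨v, hv⟩]
    exact (y i ⟨v, hv⟩).2
  obtain ⟨x, hx⟩ := exists_centralizer_eq_of_commuting_projections hQproj
    (fun m n => hQcomm m _ (hQinv n)) (fun n => hQcomm n Y hYinv)
  refine ⟨x, isGeneratedBy_singleton_iff.2 fun t => ?_⟩
  rw [hx, hgen]
  have hSinv : ∀ i, ∀ X ∈ S, ∀ v ∈ F i, X v ∈ F i := fun i X hX v hv =>
    map_mem_centralSubspace hX hv
  have hYc : ∀ i, (F i).compress Y = y i := fun i => by
    ext v
    rw [Submodule.coe_compress_apply (hYinv i v v.2), hY]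
  have hYsinv : ∀ i, ∀ v ∈ F i, star Y v ∈ F i := by
    intro i v hv
    rw [hYs i ⟨v, hv⟩]
    exact (star (y i) ⟨v, hv⟩).2
  -- For operators preserving the summands, commutation is tested on each summand, where `y i`
  -- encodes the compression of `S`.
  have key : ∀ T : H →L[ℂ] H, (∀ i, ∀ v ∈ F i, T v ∈ F i) →
      (T ∈ Set.centralizer S ↔ Commute T Y ∧ Commute T (star Y)) := by
    intro T hT
    rw [commute_iff_forall_commute_compress htot hT hYinv,
      commute_iff_forall_commute_compress htot hT hYsinv, ← forall_and]
    have h1 : ∀ i, (Commute ((F i).compress T) ((F i).compress Y) ∧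
        Commute ((F i).compress T) ((F i).compress (star Y))) ↔
        ∀ X ∈ S, Commute ((F i).compress T) ((F i).compress X) := fun i => by
      rw [← Submodule.star_compress, hYc]
      exact (hy2 i _).symm
    rw [forall_congr' h1, Set.mem_centralizer_iff]
    refine ⟨fun h i X hX => ?_, fun h X hX => ?_⟩
    · exact (commute_iff_forall_commute_compress htot hT fun i => hSinv i X hX).1 (h X hX).symm i
    · exact ((commute_iff_forall_commute_compress htot hT fun i => hSinv i X hX).2 fun i => h i X hX).symm
  -- Both directions first need the summands to be invariant: the commutant preserves central
  -- subspaces, and commuting with the separating `Q n` has the same effect.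
  constructor
  · intro ht
    have hT : ∀ i, ∀ v ∈ F i, t v ∈ F i := fun i v hv =>
      map_mem_centralSubspace_of_mem_centralizer ht hv
    exact ⟨((key t hT).1 ht).1, ((key t hT).1 ht).2, fun n => (hQcomm n t hT).symm⟩
  · rintro ⟨h1, h2, h3⟩
    exact (key t (apply_mem_of_commute_separating hF htot hq
      (fun n => (hQproj n).isSelfAdjoint) hQ h3)).2 ⟨h1, h2⟩

end Reduction

/-! ### Compactness of the unit ball and countable generation -/

section UnitBall

variable {H : Type u} [NormedAddCommGroup H] [InnerProductSpace ℂ H]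

theorem continuous_sigmaWeakTopology_inner (u v : H) :
    @Continuous _ _ (sigmaWeakTopology H) _ fun T : H →L[ℂ] H => (inner ℂ u (T v) : ℂ) := by
  have hs : ∀ w : H, Summable fun n => ‖(Pi.single 0 w : ℕ → H) n‖ ^ 2 := fun w =>
    summable_of_ne_finset_zero (s := {0}) fun n hn => by
      simp [Pi.single_eq_of_ne (show n ≠ 0 by simpa using hn)]
  have := continuous_sigmaWeakTopology_functional (hs v) (hs u)
  have h : ∀ T : H →L[ℂ] H, ∑' n, inner ℂ ((Pi.single 0 u : ℕ → H) n)
      (T ((Pi.single 0 v : ℕ → H) n)) = (inner ℂ u (T v) : ℂ) := fun T => by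
    rw [tsum_eq_single 0 fun n hn => by simp [Pi.single_eq_of_ne hn]]
    simp
  simpa only [h] using this

/-- A bounded sesquilinear form is given by an operator. -/
theorem exists_clm_of_sesquilinear [CompleteSpace H] {g : H × H → ℂ}
    (hb : ∀ u v, ‖g (u, v)‖ ≤ ‖u‖ * ‖v‖)
    (hadd₁ : ∀ u u' v, g (u + u', v) = g (u, v) + g (u', v))
    (hadd₂ : ∀ u v v', g (u, v + v') = g (u, v) + g (u, v'))
    (hsmul₁ : ∀ (c : ℂ) u v, g (c • u, v) = (starRingEnd ℂ) c * g (u, v))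
    (hsmul₂ : ∀ (c : ℂ) u v, g (u, c • v) = c * g (u, v)) :
    ∃ T : H →L[ℂ] H, ‖T‖ ≤ 1 ∧ ∀ u v, inner ℂ u (T v) = g (u, v) := by
  let B : H →L⋆[ℂ] H →L[ℂ] ℂ := LinearMap.mkContinuous₂
    (LinearMap.mk₂'ₛₗ (starRingEnd ℂ) (RingHom.id ℂ) (fun u v => g (u, v)) hadd₁ hsmul₁ hadd₂
      hsmul₂) 1 (fun u v => by simpa using hb u v)
  let T := InnerProductSpace.continuousLinearMapOfBilin B
  -- `continuousLinearMapOfBilin` puts the operator in the first slot of the inner product, hence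
  -- the adjoint.
  have hT : ∀ u v, inner ℂ u (star T v) = g (u, v) := by
    intro u v
    rw [ContinuousLinearMap.star_eq_adjoint, ContinuousLinearMap.adjoint_inner_right,
      InnerProductSpace.continuousLinearMapOfBilin_apply]
    rfl
  refine ⟨star T, ContinuousLinearMap.opNorm_le_bound _ zero_le_one fun v => ?_, hT⟩
  rw [one_mul]
  have h1 : ‖star T v‖ * ‖star T v‖ ≤ ‖star T v‖ * ‖v‖ := by
    rw [← inner_self_eq_norm_mul_norm (𝕜 := ℂ), hT]
    exact (RCLike.re_le_norm _).trans (hb _ _)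
  by_cases h0 : ‖star T v‖ = 0
  · rw [h0]
    exact norm_nonneg v
  · exact le_of_mul_le_mul_left h1 (lt_of_le_of_ne (norm_nonneg _) (Ne.symm h0))

variable [CompleteSpace H]

/-- The closed unit ball of a von Neumann algebra. -/
abbrev VonNeumannAlgebra.UnitBall (M : VonNeumannAlgebra H) : Type u :=
  {T : H →L[ℂ] H // T ∈ M ∧ ‖T‖ ≤ 1}

/-- The matrix coefficients of an operator in the unit ball. -/
noncomputable def VonNeumannAlgebra.unitBallCoeff (M : VonNeumannAlgebra H) (T : M.UnitBall) :
    H × H → ℂ :=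
  fun p => inner ℂ p.1 (T.1 p.2)

/-- The weak operator topology on the unit ball. -/
noncomputable abbrev VonNeumannAlgebra.unitBallTopology (M : VonNeumannAlgebra H) :
    TopologicalSpace M.UnitBall :=
  TopologicalSpace.induced M.unitBallCoeff inferInstance

/-- The bicommutant property as equations between matrix coefficients of `T`: moving `R` onto the
vectors makes membership a pointwise closed condition. -/
theorem VonNeumannAlgebra.mem_iff_forall_inner {M : VonNeumannAlgebra H} {T : H →L[ℂ] H} :
    T ∈ M ↔ ∀ R ∈ M.commutant, ∀ u v, (inner ℂ u (T (R v)) : ℂ) = inner ℂ (star R u) (T v) := by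
  have h1 : ∀ (R : H →L[ℂ] H) u v, (inner ℂ (star R u) (T v) : ℂ) = inner ℂ u (R (T v)) :=
    fun R u v => by
      rw [ContinuousLinearMap.star_eq_adjoint, ContinuousLinearMap.adjoint_inner_left]
  simp only [h1]
  rw [← M.commutant_commutant, mem_commutant_iff, M.commutant_commutant]
  refine forall₂_congr fun R _ => ⟨fun h u v => ?_, fun h => ?_⟩
  · exact congrArg (fun X : H →L[ℂ] H => inner ℂ u (X v)) h.symm
  · exact ContinuousLinearMap.ext fun v => (ext_inner_left ℂ fun u => h u v).symm

/-- Tychonoff: sesquilinearity and the equations for membership in `M` cut a closed subset out of a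
product of closed discs. -/
theorem VonNeumannAlgebra.isCompact_range_unitBallCoeff (M : VonNeumannAlgebra H) :
    IsCompact (Set.range M.unitBallCoeff) := by
  have hrange : Set.range M.unitBallCoeff =
      (Set.univ.pi fun p : H × H => Metric.closedBall (0 : ℂ) (‖p.1‖ * ‖p.2‖)) ∩
      ({g | ∀ u u' v, g (u + u', v) = g (u, v) + g (u', v)} ∩
      ({g | ∀ u v v', g (u, v + v') = g (u, v) + g (u, v')} ∩
      ({g | ∀ (c : ℂ) u v, g (c • u, v) = (starRingEnd ℂ) c * g (u, v)} ∩
      ({g | ∀ (c : ℂ) u v, g (u, c • v) = c * g (u, v)} ∩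
      {g | ∀ R ∈ M.commutant, ∀ u v, g (u, R v) = g (star R u, v)})))) := by
    ext g
    constructor
    · rintro ⟨T, rfl⟩
      refine ⟨fun p _ => ?_, fun u u' v => inner_add_left _ _ _, fun u v v' => ?_,
        fun c u v => inner_smul_left _ _ _, fun c u v => ?_, ?_⟩
      · rw [mem_closedBall_zero_iff]
        refine (norm_inner_le_norm _ _).trans (mul_le_mul_of_nonneg_left ?_ (norm_nonneg _))
        exact (T.1.le_opNorm _).trans (mul_le_of_le_one_left (norm_nonneg _) T.2.2)
      · simp only [unitBallCoeff, map_add, inner_add_right]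
      · simp only [unitBallCoeff, map_smul, inner_smul_right]
      · exact mem_iff_forall_inner.1 T.2.1
    · rintro ⟨hb, hadd₁, hadd₂, hsmul₁, hsmul₂, hR⟩
      obtain ⟨T, hT1, hT2⟩ := exists_clm_of_sesquilinear
        (fun u v => mem_closedBall_zero_iff.1 (hb (u, v) trivial)) hadd₁ hadd₂ hsmul₁ hsmul₂
      refine ⟨⟨T, mem_iff_forall_inner.2 fun R hRM u v => ?_, hT1⟩, funext fun p => hT2 _ _⟩
      rw [hT2, hT2, hR R hRM]
  rw [hrange]
  refine (isCompact_univ_pi fun p => isCompact_closedBall _ _).inter_right ?_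
  refine IsClosed.inter ?_ (IsClosed.inter ?_ (IsClosed.inter ?_ (IsClosed.inter ?_ ?_)))
  · simp only [Set.ofPred_forall]
    exact isClosed_iInter fun _ => isClosed_iInter fun _ => isClosed_iInter fun _ =>
      isClosed_eq (by fun_prop) (by fun_prop)
  · simp only [Set.ofPred_forall]
    exact isClosed_iInter fun _ => isClosed_iInter fun _ => isClosed_iInter fun _ =>
      isClosed_eq (by fun_prop) (by fun_prop)
  · simp only [Set.ofPred_forall]
    exact isClosed_iInter fun _ => isClosed_iInter fun _ => isClosed_iInter fun _ =>
      isClosed_eq (by fun_prop) (by fun_prop)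
  · simp only [Set.ofPred_forall]
    exact isClosed_iInter fun _ => isClosed_iInter fun _ => isClosed_iInter fun _ =>
      isClosed_eq (by fun_prop) (by fun_prop)
  · simp only [Set.ofPred_forall]
    exact isClosed_iInter fun _ => isClosed_iInter fun _ => isClosed_iInter fun _ =>
      isClosed_iInter fun _ => isClosed_eq (by fun_prop) (by fun_prop)

theorem VonNeumannAlgebra.continuous_inner_unitBall (M : VonNeumannAlgebra H) (u v : H) :
    @Continuous _ _ M.unitBallTopology _ fun T : M.UnitBall => (inner ℂ u (T.1 v) : ℂ) :=
  @Continuous.comp _ _ _ M.unitBallTopology _ _ M.unitBallCoeff (fun g => g (u, v))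
    (continuous_apply (u, v)) continuous_induced_dom

/-- The `σ`-weak topology is weaker than the weak operator topology on the unit ball. -/
theorem VonNeumannAlgebra.continuous_val_unitBall (M : VonNeumannAlgebra H) :
    @Continuous _ _ M.unitBallTopology (sigmaWeakTopology H)
      (Subtype.val : M.UnitBall → H →L[ℂ] H) := by
  refine continuous_sigmaWeakTopology_iff.2 fun ξ η hξ hη => ?_
  let _ := M.unitBallTopology
  -- Weierstrass test: on the unit ball each term is bounded by `‖ξ n‖ * ‖η n‖`, independently of
  -- `T`.
  refine continuous_tsum (u := fun n => ‖ξ n‖ ^ 2 + ‖η n‖ ^ 2)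
    (fun n => M.continuous_inner_unitBall _ _) (hξ.add hη) fun n T => ?_
  have h1 := norm_inner_le_norm (𝕜 := ℂ) (η n) (T.1 (ξ n))
  have h2 := (T.1.le_opNorm (ξ n)).trans (mul_le_of_le_one_left (norm_nonneg _) T.2.2)
  have h3 := mul_le_mul_of_nonneg_left h2 (norm_nonneg (η n))
  nlinarith [sq_nonneg (‖ξ n‖ - ‖η n‖), sq_nonneg ‖ξ n‖, sq_nonneg ‖η n‖]

/-- Separably acting von Neumann algebras are countably generated. -/
theorem VonNeumannAlgebra.IsSeparablyActing.isCountablyGenerated {M : VonNeumannAlgebra H}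
    (hM : M.IsSeparablyActing) : M.IsCountablyGenerated := by
  obtain ⟨K, _, _, _, _, π, hinj, hnormal⟩ := hM
  let _ := M.unitBallTopology
  have hind : Topology.IsInducing M.unitBallCoeff := ⟨rfl⟩
  have hcomp : CompactSpace M.UnitBall := by
    rw [← isCompact_univ_iff, hind.isCompact_iff, Set.image_univ]
    exact M.isCompact_range_unitBallCoeff
  let e := TopologicalSpace.denseSeq K
  have he : DenseRange e := TopologicalSpace.denseRange_denseSeq K
  let ι : M.UnitBall → M.toStarSubalgebra := fun T => ⟨T.1, T.2.1⟩
  have hι : @Continuous _ _ _ (TopologicalSpace.induced Subtype.val (sigmaWeakTopology H)) ι :=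
    continuous_induced_rng.2 M.continuous_val_unitBall
  have hπι : @Continuous _ _ _ (sigmaWeakTopology K) fun T => π (ι T) :=
    @Continuous.comp _ _ _ _ (_) (sigmaWeakTopology K) _ _ hnormal hι
  let g : M.UnitBall → ℕ × ℕ → ℂ := fun T p => inner ℂ (e p.1) (π (ι T) (e p.2))
  have hg : Continuous g := continuous_pi fun p =>
    @Continuous.comp _ _ _ _ (sigmaWeakTopology K) _ _ _
      (continuous_sigmaWeakTopology_inner (e p.1) (e p.2)) hπι
  have hginj : Function.Injective g := by
    intro S T hST
    have h1 : π (ι S) = π (ι T) := by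
      refine ContinuousLinearMap.coeFn_injective (he.equalizer (by fun_prop) (by fun_prop) ?_)
      funext n
      refine ext_inner_left ℂ fun u => ?_
      refine congrFun (he.equalizer (g := fun u => (inner ℂ u (π (ι S) (e n)) : ℂ))
        (h := fun u => (inner ℂ u (π (ι T) (e n)) : ℂ)) (by fun_prop) (by fun_prop) ?_) u
      funext m
      exact congrFun hST (m, n)
    exact Subtype.ext (congrArg (fun X : M.toStarSubalgebra => X.1) (hinj h1))
  -- A continuous injection of a compact space into the Hausdorff space `ℕ × ℕ → ℂ` is an embedding.
  have hsc : SecondCountableTopology M.UnitBall :=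
    (hg.isClosedEmbedding hginj).isEmbedding.secondCountableTopology
  obtain ⟨D, hDc, hD⟩ := TopologicalSpace.exists_countable_dense M.UnitBall
  refine ⟨Subtype.val '' D, hDc.image _, ?_, fun N hN => ?_⟩
  · rintro _ ⟨T, _, rfl⟩
    exact T.2.1
  -- Membership in `N` is an equality of continuous functions of `T`, already known on the dense set
  -- `D`.
  have hball : ∀ T : M.UnitBall, T.1 ∈ N := by
    intro T
    rw [mem_iff_forall_inner]
    intro R hR u v
    refine congrFun (Continuous.ext_on hD (M.continuous_inner_unitBall u (R v))
      (M.continuous_inner_unitBall (star R u) v) fun S hS => ?_) T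
    exact mem_iff_forall_inner.1 (hN ⟨S, hS, rfl⟩) R hR u v
  intro T hT
  have hpos : 0 < ‖T‖ + 1 := by positivity
  have h1 : ((‖T‖ + 1 : ℝ) : ℂ)⁻¹ • T ∈ M := M.toStarSubalgebra.smul_mem hT _
  have h2 : ((‖T‖ + 1 : ℝ) : ℂ)⁻¹ • T ∈ N := hball ⟨_, h1, by
    rw [norm_smul, norm_inv, Complex.norm_real, Real.norm_of_nonneg hpos.le,
      inv_mul_le_one₀ hpos]
    linarith⟩
  have h3 : ((‖T‖ + 1 : ℝ) : ℂ) • ((‖T‖ + 1 : ℝ) : ℂ)⁻¹ • T ∈ N :=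
    N.toStarSubalgebra.smul_mem h2 _
  rwa [smul_smul, mul_inv_cancel₀ (Complex.ofReal_ne_zero.2 hpos.ne'), one_smul] at h3

end UnitBall

theorem theorem3p4 :
    (∀ (H : Type u) [NormedAddCommGroup H] [InnerProductSpace ℂ H] [CompleteSpace H]
        (M : VonNeumannAlgebra H), M.IsSeparablyActing → M.IsSinglyGenerated) ↔
      (∀ (H : Type u) [NormedAddCommGroup H] [InnerProductSpace ℂ H] [CompleteSpace H]
        (M : VonNeumannAlgebra H), M.IsCountablyGenerated → M.IsSinglyGenerated) := by
  constructor
  · intro h H _ _ _ M hM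
    exact hM.isSinglyGenerated h
  · intro h H _ _ _ M hM
    exact h H M hM.isCountablyGenerated
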